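/- Let $\Xi_-\subset\mathbb{R}^3$ be a bounded connected open set containing the origin, with $\mathscr{C}^\infty$ boundary. Let $\sigma_-<0<\sigma_+$ be real constants with $\kappa_\sigma:=\sigma_- /\sigma_+\neq-1$, and let $\sigma^\infty:=\sigma_-$ in $\Xi_-$ and $\sigma^\infty:=\sigma_+$ in $\mathbb{R}^3\setminus\overline{\Xi_-}$. Let $\mathrm{B}^\infty$ be the unbounded operator on the complex Hilbert space $\mathrm{L}^2(\mathbb{R}^3)$ given by $$\mathrm{B}^\infty w=-\mathrm{div}(\sigma^\infty\nabla w),\qquad D(\mathrm{B}^\infty)=\{w\in \mathrm{H}^1(\mathbb{R}^3)\;|\;\mathrm{div}(\sigma^\infty\nabla w)\in \mathrm{L}^2(\mathbb{R}^3)\},$$ where $\nabla$ and $\mathrm{div}$ are taken in the sense of distributions. Let $\mu\in\mathbb{C}\setminus[0,+\infty)$ be an eigenvalue of $\mathrm{B}^\infty$ (as $\mathrm{B}^\infty$ is self-adjoint, this means a negative eigenvalue), and let $w\in D(\mathrm{B}^\infty)$ satisfy $\mathrm{B}^\infty w=\mu w$ and $\|w\|_{\mathrm{L}^2(\mathbb{R}^3)}=1$.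 Then $$\int_{\mathbb{R}^3}\big(|w(\xi)|^2+|\nabla w(\xi)|^2\big)\exp\Big(|\xi|\sqrt{|\mu|/\sigma_+}\Big)\,d\xi<+\infty.$$ -/

import Mathlib

open MeasureTheory
open scoped ContDiff

/-- The space `ℝ³` with its Euclidean norm. -/
abbrev R3 : Type := EuclideanSpace ℝ (Fin 3)

/-- The space `ℂ³` with its Hermitian norm: values of gradients of complex functions. -/
abbrev C3 : Type := EuclideanSpace ℂ (Fin 3)

/-- `L²(ℝ³)`, complex valued. -/
abbrev L2 : Type := Lp ℂ 2 (volume : Measure R3)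

/-- `L²(ℝ³)³`, complex vector fields. -/
abbrev L2Vec : Type := Lp C3 2 (volume : Measure R3)

/-- Bounded domain of `ℝ³` (nonempty, open, connected, bounded) with `C^∞` boundary: near each
boundary point the domain is the sublevel set `{ρ < 0}` of a smooth function with nonvanishing
differential at that point. -/
structure IsSmoothBoundedDomain (Ξ : Set R3) : Prop where
  isOpen : IsOpen Ξ
  isConnected : IsConnected Ξ
  isBounded : Bornology.IsBounded Ξ
  smooth_boundary : ∀ x ∈ frontier Ξ, ∃ U : Set R3, IsOpen U ∧ x ∈ U ∧
    ∃ ρ : R3 → ℝ, ContDiff ℝ ∞ ρ ∧ fderiv ℝ ρ x ≠ 0 ∧ Ξ ∩ U = {y | ρ y < 0} ∩ U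

/-- Test functions `φ ∈ C₀^∞(ℝ³)`. -/
structure IsTest (φ : R3 → ℝ) : Prop where
  smooth : ContDiff ℝ ∞ φ
  compact : HasCompactSupport φ

/-- The classical partial derivative `∂φ/∂xᵢ` of a real function. -/
noncomputable def partialDeriv (i : Fin 3) (φ : R3 → ℝ) (x : R3) : ℝ :=
  fderiv ℝ φ x (EuclideanSpace.single i 1)

/-- `G` is the gradient of `w` in the sense of distributions:
`∫ w ∂ᵢφ = -∫ Gᵢ φ` for all `i` and all test functions `φ`. -/
structure IsWeakGradient (w : R3 → ℂ) (G : R3 → C3) : Prop where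
  locInt : LocallyIntegrable w volume
  locInt_grad : ∀ i, LocallyIntegrable (fun x => G x i) volume
  eq : ∀ φ : R3 → ℝ, IsTest φ → ∀ i,
    ∫ x, partialDeriv i φ x • w x = -∫ x, φ x • G x i

/-- `f` is the divergence of the vector field `F` in the sense of distributions:
`∫ F · ∇φ = -∫ f φ` for all test functions `φ`. -/
structure IsWeakDivergence (F : R3 → C3) (f : R3 → ℂ) : Prop where
  locInt : ∀ i, LocallyIntegrable (fun x => F x i) volume
  locInt_div : LocallyIntegrable f volume
  eq : ∀ φ : R3 → ℝ, IsTest φ →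
    ∫ x, ∑ i, partialDeriv i φ x • F x i = -∫ x, φ x • f x

theorem IsTest.integrable_smul {φ : R3 → ℝ} (hφ : IsTest φ) {f : R3 → ℂ}
    (hf : LocallyIntegrable f volume) : Integrable (fun x => φ x • f x) :=
  hf.integrable_smul_left_of_hasCompactSupport hφ.smooth.continuous hφ.compact

theorem IsTest.integrable_partialDeriv_smul {φ : R3 → ℝ} (hφ : IsTest φ) (i : Fin 3)
    {f : R3 → ℂ} (hf : LocallyIntegrable f volume) :
    Integrable (fun x => partialDeriv i φ x • f x) := by
  refine hf.integrable_smul_left_of_hasCompactSupport ?_ ?_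
  · exact (hφ.smooth.continuous_fderiv (by simp)).clm_apply continuous_const
  · exact hφ.compact.fderiv_apply ℝ _

theorem ae_eq_of_test {f g : R3 → ℂ} (hf : LocallyIntegrable f volume)
    (hg : LocallyIntegrable g volume)
    (h : ∀ φ, IsTest φ → ∫ x, φ x • f x = ∫ x, φ x • g x) : f =ᵐ[volume] g :=
  ae_eq_of_integral_contDiff_smul_eq hf hg fun φ h1 h2 => h φ ⟨h1, h2⟩

theorem IsWeakGradient.unique {w : R3 → ℂ} {G G' : R3 → C3} (h : IsWeakGradient w G)
    (h' : IsWeakGradient w G') : G =ᵐ[volume] G' := by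
  have key : ∀ i, (fun x => G x i) =ᵐ[volume] fun x => G' x i := fun i =>
    ae_eq_of_test (h.locInt_grad i) (h'.locInt_grad i) fun φ hφ => by
      have := (h.eq φ hφ i).symm.trans (h'.eq φ hφ i)
      exact neg_injective this
  filter_upwards [ae_all_iff.2 key] with x hx
  ext i
  exact hx i

theorem IsWeakGradient.congr {w w' : R3 → ℂ} {G G' : R3 → C3} (h : IsWeakGradient w G)
    (hw : w =ᵐ[volume] w') (hG : G =ᵐ[volume] G') : IsWeakGradient w' G' := by
  have hGi : ∀ i, (fun x => G x i) =ᵐ[volume] fun x => G' x i := fun i => by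
    filter_upwards [hG] with x hx
    rw [hx]
  refine ⟨h.locInt.congr hw, fun i => (h.locInt_grad i).congr (hGi i), fun φ hφ i => ?_⟩
  rw [← integral_congr_ae (hw.mono fun x hx => congrArg (partialDeriv i φ x • ·) hx),
    ← integral_congr_ae ((hGi i).mono fun x hx => congrArg (φ x • ·) hx)]
  exact h.eq φ hφ i

theorem IsWeakGradient.add {w w' : R3 → ℂ} {G G' : R3 → C3} (h : IsWeakGradient w G)
    (h' : IsWeakGradient w' G') : IsWeakGradient (w + w') (G + G') := by
  refine ⟨h.locInt.add h'.locInt, fun i => (h.locInt_grad i).add (h'.locInt_grad i),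
    fun φ hφ i => ?_⟩
  simp only [Pi.add_apply, PiLp.add_apply, smul_add]
  rw [integral_add (hφ.integrable_partialDeriv_smul i h.locInt)
    (hφ.integrable_partialDeriv_smul i h'.locInt),
    integral_add (hφ.integrable_smul (h.locInt_grad i))
    (hφ.integrable_smul (h'.locInt_grad i)), h.eq φ hφ, h'.eq φ hφ, neg_add]

theorem IsWeakGradient.smul {w : R3 → ℂ} {G : R3 → C3} (c : ℂ) (h : IsWeakGradient w G) :
    IsWeakGradient (c • w) (c • G) := by
  refine ⟨h.locInt.smul c, fun i => (h.locInt_grad i).smul c, fun φ hφ i => ?_⟩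
  simp only [Pi.smul_apply, PiLp.smul_apply, smul_comm _ c]
  rw [integral_smul, integral_smul, h.eq φ hφ, smul_neg]

theorem IsWeakGradient.zero : IsWeakGradient 0 0 :=
  ⟨locallyIntegrable_zero, fun _ => locallyIntegrable_zero, fun φ _ i => by simp⟩

theorem IsWeakDivergence.unique {F : R3 → C3} {f f' : R3 → ℂ} (h : IsWeakDivergence F f)
    (h' : IsWeakDivergence F f') : f =ᵐ[volume] f' :=
  ae_eq_of_test h.locInt_div h'.locInt_div fun φ hφ =>
    neg_injective ((h.eq φ hφ).symm.trans (h'.eq φ hφ))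

theorem IsWeakDivergence.congr {F F' : R3 → C3} {f f' : R3 → ℂ} (h : IsWeakDivergence F f)
    (hF : F =ᵐ[volume] F') (hf : f =ᵐ[volume] f') : IsWeakDivergence F' f' := by
  refine ⟨fun i => (h.locInt i).congr (hF.mono fun x hx => congrArg (fun v : C3 => v i) hx),
    h.locInt_div.congr hf, fun φ hφ => ?_⟩
  rw [← integral_congr_ae
      (hF.mono fun x hx => congrArg (fun v : C3 => ∑ i, partialDeriv i φ x • v i) hx),
    ← integral_congr_ae (hf.mono fun x hx => congrArg (φ x • ·) hx)]
  exact h.eq φ hφ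

theorem IsWeakDivergence.add {F F' : R3 → C3} {f f' : R3 → ℂ} (h : IsWeakDivergence F f)
    (h' : IsWeakDivergence F' f') : IsWeakDivergence (F + F') (f + f') := by
  refine ⟨fun i => (h.locInt i).add (h'.locInt i), h.locInt_div.add h'.locInt_div,
    fun φ hφ => ?_⟩
  simp only [Pi.add_apply, PiLp.add_apply, smul_add, Finset.sum_add_distrib]
  rw [integral_add
      (integrable_finsetSum _ fun i _ => hφ.integrable_partialDeriv_smul i (h.locInt i))
      (integrable_finsetSum _ fun i _ => hφ.integrable_partialDeriv_smul i (h'.locInt i)),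
    integral_add (hφ.integrable_smul h.locInt_div) (hφ.integrable_smul h'.locInt_div),
    h.eq φ hφ, h'.eq φ hφ, neg_add]

theorem IsWeakDivergence.smul {F : R3 → C3} {f : R3 → ℂ} (c : ℂ) (h : IsWeakDivergence F f) :
    IsWeakDivergence (c • F) (c • f) := by
  refine ⟨fun i => (h.locInt i).smul c, h.locInt_div.smul c, fun φ hφ => ?_⟩
  simp only [Pi.smul_apply, PiLp.smul_apply, smul_comm _ c, ← Finset.smul_sum]
  rw [integral_smul, integral_smul, h.eq φ hφ, smul_neg]

theorem IsWeakDivergence.zero : IsWeakDivergence 0 0 :=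
  ⟨fun _ => locallyIntegrable_zero, locallyIntegrable_zero, fun φ _ => by simp⟩

/-- The Sobolev space `H¹(ℝ³)`: the functions of `L²` whose gradient in the sense of
distributions is in `L²`. -/
def H1 : Submodule ℂ L2 where
  carrier := {w | ∃ G : L2Vec, IsWeakGradient w G}
  zero_mem' := ⟨0, IsWeakGradient.zero.congr (Lp.coeFn_zero _ _ _).symm
    (Lp.coeFn_zero _ _ _).symm⟩
  add_mem' := by
    rintro w w' ⟨G, h⟩ ⟨G', h'⟩
    exact ⟨G + G', (h.add h').congr (Lp.coeFn_add _ _).symm (Lp.coeFn_add _ _).symm⟩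
  smul_mem' := by
    rintro c w ⟨G, h⟩
    exact ⟨c • G, (h.smul c).congr (Lp.coeFn_smul _ _).symm (Lp.coeFn_smul _ _).symm⟩

/-- The gradient `∇ : H¹(ℝ³) → L²(ℝ³)³`. -/
noncomputable def grad : H1 →ₗ[ℂ] L2Vec where
  toFun w := w.2.choose
  map_add' w w' := Lp.ext <| (w + w').2.choose_spec.unique <|
    (w.2.choose_spec.add w'.2.choose_spec).congr
      (Lp.coeFn_add _ _).symm (Lp.coeFn_add _ _).symm
  map_smul' c w := Lp.ext <| (c • w).2.choose_spec.unique <|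
    (w.2.choose_spec.smul c).congr (Lp.coeFn_smul _ _).symm (Lp.coeFn_smul _ _).symm

theorem isWeakGradient_grad (w : H1) : IsWeakGradient (w : L2) (grad w) := w.2.choose_spec

theorem grad_eq_iff (w : H1) (G : L2Vec) : grad w = G ↔ IsWeakGradient (w : L2) G :=
  ⟨fun h => h ▸ isWeakGradient_grad w, fun h => Lp.ext ((isWeakGradient_grad w).unique h)⟩

open Classical in
/-- The coefficient `σ^∞`: `σ₋` in the inclusion `Ξ` (and on its boundary, a null set), `σ₊`
outside. -/
noncomputable def sigmaInf (Ξ : Set R3) (σm σp : ℝ) (x : R3) : ℝ :=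
  if x ∈ closure Ξ then σm else σp

/-- The flux `σ^∞ ∇w` of `w ∈ H¹(ℝ³)`. -/
noncomputable def flux (Ξ : Set R3) (σm σp : ℝ) (w : H1) : R3 → C3 :=
  fun x => (sigmaInf Ξ σm σp x : ℂ) • grad w x

theorem flux_add (Ξ : Set R3) (σm σp : ℝ) (w w' : H1) :
    flux Ξ σm σp w + flux Ξ σm σp w' =ᵐ[volume] flux Ξ σm σp (w + w') := by
  filter_upwards [Lp.coeFn_add (grad w) (grad w')] with x hx
  simp only [flux, map_add, hx, Pi.add_apply, smul_add]

theorem flux_smul (Ξ : Set R3) (σm σp : ℝ) (c : ℂ) (w : H1) :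
    c • flux Ξ σm σp w =ᵐ[volume] flux Ξ σm σp (c • w) := by
  filter_upwards [Lp.coeFn_smul c (grad w)] with x hx
  simp only [flux, map_smul, hx, Pi.smul_apply, smul_comm c]

/-- The domain `{w ∈ H¹(ℝ³) | div (σ^∞ ∇w) ∈ L²(ℝ³)}` of the near field operator. -/
noncomputable def nearFieldDomain (Ξ : Set R3) (σm σp : ℝ) : Submodule ℂ L2 where
  carrier := {w | ∃ h : w ∈ H1, ∃ f : L2, IsWeakDivergence (flux Ξ σm σp ⟨w, h⟩) f}
  zero_mem' := by
    refine ⟨H1.zero_mem, 0, IsWeakDivergence.zero.congr ?_ (Lp.coeFn_zero _ _ _).symm⟩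
    have h := flux_smul Ξ σm σp 0 0
    rw [zero_smul, zero_smul] at h
    exact h
  add_mem' := by
    rintro w w' ⟨hw, f, hf⟩ ⟨hw', f', hf'⟩
    exact ⟨H1.add_mem hw hw', f + f',
      (hf.add hf').congr (flux_add Ξ σm σp ⟨w, hw⟩ ⟨w', hw'⟩) (Lp.coeFn_add _ _).symm⟩
  smul_mem' := by
    rintro c w ⟨hw, f, hf⟩
    exact ⟨H1.smul_mem c hw, c • f,
      (hf.smul c).congr (flux_smul Ξ σm σp c ⟨w, hw⟩) (Lp.coeFn_smul _ _).symm⟩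

theorem nearFieldDomain_le (Ξ : Set R3) (σm σp : ℝ) : nearFieldDomain Ξ σm σp ≤ H1 :=
  fun _ h => h.1

/-- An element of the domain of the near field operator, seen as an element of `H¹(ℝ³)`. -/
def toH1 {Ξ : Set R3} {σm σp : ℝ} (w : nearFieldDomain Ξ σm σp) : H1 :=
  ⟨w, nearFieldDomain_le Ξ σm σp w.2⟩

/-- The map `w ↦ div (σ^∞ ∇w)` on the domain of the near field operator. -/
noncomputable def divFlux (Ξ : Set R3) (σm σp : ℝ) :
    nearFieldDomain Ξ σm σp →ₗ[ℂ] L2 where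
  toFun w := w.2.choose_spec.choose
  map_add' w w' := Lp.ext <| (w + w').2.choose_spec.choose_spec.unique <|
    (w.2.choose_spec.choose_spec.add w'.2.choose_spec.choose_spec).congr
      (flux_add Ξ σm σp (toH1 w) (toH1 w')) (Lp.coeFn_add _ _).symm
  map_smul' c w := Lp.ext <| (c • w).2.choose_spec.choose_spec.unique <|
    (w.2.choose_spec.choose_spec.smul c).congr
      (flux_smul Ξ σm σp c (toH1 w)) (Lp.coeFn_smul _ _).symm

theorem isWeakDivergence_divFlux {Ξ : Set R3} {σm σp : ℝ} (w : nearFieldDomain Ξ σm σp) :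
    IsWeakDivergence (flux Ξ σm σp (toH1 w)) (divFlux Ξ σm σp w) :=
  w.2.choose_spec.choose_spec

/-- The near field operator `B^∞ w = -div (σ^∞ ∇w)`, an unbounded operator on `L²(ℝ³)` with
domain `{w ∈ H¹(ℝ³) | div (σ^∞ ∇w) ∈ L²(ℝ³)}`. -/
noncomputable def nearField (Ξ : Set R3) (σm σp : ℝ) : L2 →ₗ.[ℂ] L2 where
  domain := nearFieldDomain Ξ σm σp
  toFun := -divFlux Ξ σm σp

/-- `w` is an eigenfunction of the unbounded operator `T` for the eigenvalue `μ`. -/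
def IsEigenfunction (T : L2 →ₗ.[ℂ] L2) (μ : ℂ) (w : T.domain) : Prop :=
  w ≠ 0 ∧ T w = μ • (w : L2)

open scoped Convolution ComplexConjugate

/-! This is an Agmon estimate. Write `α = √(|μ|/σ₊)` and let `η` be a bounded smooth weight
vanishing on a ball that contains the closure of the inclusion. Testing `div (σ∇w) = -μw` against
`η² w̄` gives `∫ σ∇w · ∇(η² w̄) = μ ∫ η²|w|²`. The integrand on the left vanishes where `σ` is
negative, so only `σ₊` enters. If `|∇η|² ≤ (α/2)²η² + K`, Young's inequality bounds the cross term
by `σ₊ (½η²|∇w|² + ½α²η²|w|² + 2K|w|²)`. On the right `μ = -σ₊α²`, so half of `α²η²|w|²` survives,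
and `∫ η²(|w|² + |∇w|²)` is bounded in terms of `K` and `α` only
(`IsEigenfunction.weighted_energy_le`).

The weights of `exists_weights` are bounded and smooth, share one `K`, and converge to a limit whose
square grows like `exp(α|x|)`. Fatou's lemma then concludes.

The technical cost lies in making `η² w̄` an admissible test function:
`IsWeakDivergence.integral_mul_grad` handles compactly supported H¹ functions, and
`integral_energyIntegrand` removes the compact support. -/

/-! ### Products and conjugates of weakly differentiable functions -/

theorem continuous_partialDeriv {θ : R3 → ℝ} (hθ : ContDiff ℝ ∞ θ) (i : Fin 3) :
    Continuous (partialDeriv i θ) :=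
  (hθ.continuous_fderiv (by simp)).clm_apply continuous_const

theorem partialDeriv_mul {φ θ : R3 → ℝ} (hφ : ContDiff ℝ ∞ φ) (hθ : ContDiff ℝ ∞ θ) (i : Fin 3)
    (x : R3) : partialDeriv i (fun y => φ y * θ y) x =
      partialDeriv i φ x * θ x + φ x * partialDeriv i θ x := by
  have h1 : DifferentiableAt ℝ φ x := hφ.contDiffAt.differentiableAt (by simp)
  have h2 : DifferentiableAt ℝ θ x := hθ.contDiffAt.differentiableAt (by simp)
  simp only [partialDeriv]
  rw [fderiv_fun_mul h1 h2]
  simp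
  ring

theorem IsTest.mul_smooth {φ θ : R3 → ℝ} (hφ : IsTest φ) (hθ : ContDiff ℝ ∞ θ) :
    IsTest fun x => φ x * θ x :=
  ⟨hφ.smooth.mul hθ, hφ.compact.mul_right⟩

theorem locallyIntegrable_continuous_smul {θ : R3 → ℝ} (hθ : Continuous θ) {f : R3 → ℂ}
    (hf : LocallyIntegrable f volume) : LocallyIntegrable (fun x => θ x • f x) volume := by
  rw [← locallyIntegrableOn_univ] at hf ⊢
  exact hf.continuousOn_smul isOpen_univ.isLocallyClosed hθ.continuousOn

/-- The gradient of `θ w` for real `θ`, given the gradient `G` of `w`. -/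
noncomputable def productGrad (θ : R3 → ℝ) (w : R3 → ℂ) (G : R3 → C3) (x : R3) : C3 :=
  WithLp.toLp 2 fun i => θ x • G x i + partialDeriv i θ x • w x

/-- Test the gradient of `w` against `φθ`, which is again a test function, and expand by Leibniz. -/
theorem IsWeakGradient.smooth_smul {w : R3 → ℂ} {G : R3 → C3} (h : IsWeakGradient w G)
    {θ : R3 → ℝ} (hθ : ContDiff ℝ ∞ θ) :
    IsWeakGradient (fun x => θ x • w x) (productGrad θ w G) := by
  have h1 : ∀ i, LocallyIntegrable (fun x => θ x • G x i) volume := fun i =>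
    locallyIntegrable_continuous_smul hθ.continuous (h.locInt_grad i)
  have h2 : ∀ i, LocallyIntegrable (fun x => partialDeriv i θ x • w x) volume := fun i =>
    locallyIntegrable_continuous_smul (continuous_partialDeriv hθ i) h.locInt
  refine ⟨locallyIntegrable_continuous_smul hθ.continuous h.locInt,
    fun i => (h1 i).add (h2 i), fun φ hφ i => ?_⟩
  have e := h.eq _ (hφ.mul_smooth hθ) i
  simp only [partialDeriv_mul hφ.smooth hθ] at e
  simp only [productGrad, smul_add]
  rw [integral_add (hφ.integrable_smul (h1 i)) (hφ.integrable_smul (h2 i))]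
  have h3 : Integrable (fun x => partialDeriv i φ x • θ x • w x) :=
    hφ.integrable_partialDeriv_smul i (locallyIntegrable_continuous_smul hθ.continuous h.locInt)
  simp only [add_smul, mul_smul] at e
  rw [integral_add h3 (hφ.integrable_smul (h2 i))] at e
  linear_combination e

theorem IsWeakGradient.conj {w : R3 → ℂ} {G : R3 → C3} (h : IsWeakGradient w G) :
    IsWeakGradient (fun x => conj (w x)) fun x => WithLp.toLp 2 fun i => conj (G x i) := by
  have hc : ∀ f : R3 → ℂ, LocallyIntegrable f volume →
      LocallyIntegrable (fun x => conj (f x)) volume := fun f hf x => by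
    obtain ⟨s, hs, hi⟩ := hf x
    exact ⟨s, hs, (Complex.conjCLE : ℂ →L[ℝ] ℂ).integrable_comp hi⟩
  refine ⟨hc _ h.locInt, fun i => hc _ (h.locInt_grad i), fun φ hφ i => ?_⟩
  have e := congrArg conj (h.eq φ hφ i)
  rw [map_neg, ← integral_conj, ← integral_conj] at e
  simpa [Complex.real_smul] using e

/-! ### Weak divergence tested against compactly supported H¹ functions -/

theorem IsWeakDivergence.eq_complex {F : R3 → C3} {f : R3 → ℂ} (h : IsWeakDivergence F f)
    {φ : R3 → ℂ} (hφ : ContDiff ℝ ∞ φ) (hc : HasCompactSupport φ) :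
    ∫ x, ∑ i, F x i * fderiv ℝ φ x (EuclideanSpace.single i 1) = -∫ x, f x * φ x := by
  have hre : IsTest fun x => (φ x).re :=
    ⟨Complex.reCLM.contDiff.comp hφ, hc.comp_left (g := Complex.re) rfl⟩
  have him : IsTest fun x => (φ x).im :=
    ⟨Complex.imCLM.contDiff.comp hφ, hc.comp_left (g := Complex.im) rfl⟩
  have hd : ∀ x, DifferentiableAt ℝ φ x := fun x => hφ.contDiffAt.differentiableAt (by simp)
  have pre : ∀ i x, partialDeriv i (fun x => (φ x).re) x =
      (fderiv ℝ φ x (EuclideanSpace.single i 1)).re := fun i x => by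
    have := (Complex.reCLM.hasFDerivAt.comp x (hd x).hasFDerivAt).fderiv
    simp only [partialDeriv]
    erw [this]
    rfl
  have pim : ∀ i x, partialDeriv i (fun x => (φ x).im) x =
      (fderiv ℝ φ x (EuclideanSpace.single i 1)).im := fun i x => by
    have := (Complex.imCLM.hasFDerivAt.comp x (hd x).hasFDerivAt).fderiv
    simp only [partialDeriv]
    erw [this]
    rfl
  have e1 := h.eq _ hre
  have e2 := h.eq _ him
  have i1 := integrable_finsetSum Finset.univ fun i _ =>
    hre.integrable_partialDeriv_smul i (h.locInt i)
  have i2 := integrable_finsetSum Finset.univ fun i _ =>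
    him.integrable_partialDeriv_smul i (h.locInt i)
  have j1 := hre.integrable_smul h.locInt_div
  have j2 := him.integrable_smul h.locInt_div
  have k1 : ∀ x, ∑ i, F x i * fderiv ℝ φ x (EuclideanSpace.single i 1) =
      ∑ i, partialDeriv i (fun x => (φ x).re) x • F x i +
        Complex.I * ∑ i, partialDeriv i (fun x => (φ x).im) x • F x i := fun x => by
    rw [Finset.mul_sum, ← Finset.sum_add_distrib]
    refine Finset.sum_congr rfl fun i _ => ?_
    rw [pre, pim, Complex.real_smul, Complex.real_smul]
    conv_lhs => rw [← Complex.re_add_im (fderiv ℝ φ x (EuclideanSpace.single i 1))]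
    ring
  have k2 : ∀ x, f x * φ x = (φ x).re • f x + Complex.I * ((φ x).im • f x) := fun x => by
    rw [Complex.real_smul, Complex.real_smul]
    conv_lhs => rw [← Complex.re_add_im (φ x)]
    ring
  simp only [k1, k2]
  rw [integral_add i1 (i2.const_mul _), integral_add j1 (j2.const_mul _),
    integral_const_mul, integral_const_mul, e1, e2]
  ring

theorem memLp_translate {g : R3 → ℂ} (hg : MemLp g 2 volume) (y : R3) :
    MemLp (fun x => g (x - y)) 2 volume :=
  hg.comp_measurePreserving (measurePreserving_sub_right volume y)

/-- The integral is the inner product of `star F` with a translate of `g`, and translation is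
continuous in L². -/
theorem continuous_integral_mul_translate {F g : R3 → ℂ} (hF : MemLp F 2 volume)
    (hg : MemLp g 2 volume) : Continuous fun y => ∫ x, F x * g (x - y) := by
  let τ : R3 → C(R3, R3) := fun y => ⟨fun x => x - y, by fun_prop⟩
  have hτ : Continuous τ := ContinuousMap.continuous_of_continuous_uncurry _ (by
    change Continuous fun p : R3 × R3 => p.2 - p.1
    fun_prop)
  have hm : ∀ y, MeasurePreserving (τ y) (volume : Measure R3) volume := fun y =>
    measurePreserving_sub_right volume y
  have hc := Continuous.compMeasurePreservingLp (μ := (volume : Measure R3))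
    (f := fun _ : R3 => hg.toLp g) continuous_const hτ hm (by simp)
  have := (continuous_const (y := hF.star.toLp (star F))).inner (𝕜 := ℂ) hc
  refine this.congr fun y => ?_
  rw [L2.inner_def]
  refine integral_congr_ae ?_
  filter_upwards [hF.star.coeFn_toLp, Lp.coeFn_compMeasurePreserving (hg.toLp g) (hm y),
    (hm y).quasiMeasurePreserving.ae_eq_comp hg.coeFn_toLp] with x h1 h2 h3
  rw [h1, h2, h3]
  simp [τ, mul_comm]

theorem integral_mul_translate_smul {F g : R3 → ℂ} (hF : MemLp F 2 volume)
    (hg : MemLp g 2 volume) {ρ : R3 → ℝ} (hρ : Continuous ρ) (hc : HasCompactSupport ρ) :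
    Integrable (fun x => F x * ∫ y, ρ y • g (x - y)) ∧
    ∫ y, ρ y • ∫ x, F x * g (x - y) = ∫ x, F x * ∫ y, ρ y • g (x - y) := by
  have hmeas : AEStronglyMeasurable (fun p : R3 × R3 => ρ p.1 • (F p.2 * g (p.2 - p.1)))
      (volume.prod volume) := by
    refine (hρ.aestronglyMeasurable.comp_fst).smul (hF.1.comp_snd.mul ?_)
    have : Measure.QuasiMeasurePreserving (fun p : R3 × R3 => p.2 - p.1)
        (volume.prod volume) volume :=
      (quasiMeasurePreserving_sub volume volume).comp
        Measure.measurePreserving_swap.quasiMeasurePreserving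
    exact hg.1.comp_quasiMeasurePreserving this
  have hint : Integrable (fun p : R3 × R3 => ρ p.1 • (F p.2 * g (p.2 - p.1)))
      (volume.prod volume) := by
    rw [integrable_prod_iff hmeas]
    refine ⟨.of_forall fun y => ((hF.integrable_mul (memLp_translate hg y)).smul (ρ y)), ?_⟩
    have hF' : MemLp (fun x => ((‖F x‖ : ℝ) : ℂ)) 2 volume := hF.norm.ofReal
    have hg' : MemLp (fun x => ((‖g x‖ : ℝ) : ℂ)) 2 volume := hg.norm.ofReal
    have hcont := (Complex.continuous_re.comp (continuous_integral_mul_translate hF' hg'))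
    have := (hρ.norm.mul hcont).integrable_of_hasCompactSupport (μ := volume)
      (hc.norm.mul_right)
    refine this.congr (.of_forall fun y => ?_)
    simp only [norm_smul, norm_mul, Function.comp, ← Complex.ofReal_mul, Pi.mul_apply]
    rw [integral_complex_ofReal, Complex.ofReal_re, ← integral_const_mul]
  have e1 : ∀ x, ∫ y, ρ y • (F x * g (x - y)) = F x * ∫ y, ρ y • g (x - y) := fun x => by
    rw [← integral_const_mul]
    simp only [mul_smul_comm]
  constructor
  · have := hint.integral_prod_right
    simpa only [e1] using this
  · have := integral_integral_swap (f := fun y x => ρ y • (F x * g (x - y))) hint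
    simpa only [integral_smul, e1] using this

theorem IsTest.comp_sub_left {ρ : R3 → ℝ} (hρ : IsTest ρ) (x : R3) : IsTest fun t => ρ (x - t) :=
  ⟨hρ.smooth.comp (contDiff_const.sub contDiff_id),
    hρ.compact.comp_homeomorph (Homeomorph.subLeft x)⟩

theorem partialDeriv_comp_sub_left {ρ : R3 → ℝ} (hρ : IsTest ρ) (x t : R3) (i : Fin 3) :
    partialDeriv i (fun t => ρ (x - t)) t = -partialDeriv i ρ (x - t) := by
  have h1 : HasFDerivAt ρ (fderiv ℝ ρ (x - t)) (x - t) :=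
    (hρ.smooth.contDiffAt.differentiableAt (by simp)).hasFDerivAt
  have h2 := h1.comp t ((hasFDerivAt_id t).const_sub x)
  have h3 : fderiv ℝ (fun t => ρ (x - t)) t = _ := h2.fderiv
  simp [partialDeriv, h3]

/-- The derivative first falls on `ρ`; the weak gradient, tested on `t ↦ ρ (x - t)`, moves it to
`v`. The sign of the reflection cancels the one of integration by parts. -/
theorem IsWeakGradient.fderiv_convolution {v : R3 → ℂ} {G : R3 → C3} (h : IsWeakGradient v G)
    {ρ : R3 → ℝ} (hρ : IsTest ρ) (x : R3) (i : Fin 3) :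
    fderiv ℝ (ρ ⋆[ContinuousLinearMap.lsmul ℝ ℝ, volume] v) x (EuclideanSpace.single i 1) =
      ∫ y, ρ y • G (x - y) i := by
  have hd := hρ.compact.hasFDerivAt_convolution_left (μ := volume)
    (ContinuousLinearMap.lsmul ℝ ℝ : ℝ →L[ℝ] ℂ →L[ℝ] ℂ) (hρ.smooth.of_le (by simp)) h.locInt x
  have hex : ConvolutionExistsAt (fderiv ℝ ρ) v x
      ((ContinuousLinearMap.lsmul ℝ ℝ : ℝ →L[ℝ] ℂ →L[ℝ] ℂ).precompL R3) volume :=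
    (hρ.compact.fderiv (𝕜 := ℝ)).convolutionExists_left _
      (hρ.smooth.continuous_fderiv (by simp)) h.locInt x
  rw [hd.fderiv, convolution_def, ContinuousLinearMap.integral_apply hex]
  have e := h.eq _ (hρ.comp_sub_left x) i
  simp only [partialDeriv_comp_sub_left hρ, neg_smul, integral_neg, neg_inj] at e
  rw [← integral_sub_left_eq_self (fun y => ρ y • G (x - y) i) volume x]
  simp only [sub_sub_cancel]
  rw [← e, ← integral_sub_left_eq_self _ volume x]
  simp [partialDeriv, ContinuousLinearMap.precompL]

/-- Translate `v` by `y`: both sides become continuous functions of `y`. Integrated against a test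
function `ρ`, they are the two sides of the divergence identity for the smooth function `ρ ⋆ v`.
They therefore agree for almost every `y`, hence for all `y`, in particular at `y = 0`. -/
theorem IsWeakDivergence.integral_mul_grad {F : R3 → C3} {f : R3 → ℂ} (h : IsWeakDivergence F f)
    (hF : ∀ i, MemLp (fun x => F x i) 2 volume) (hf : MemLp f 2 volume)
    {v : R3 → ℂ} {G : R3 → C3} (hG : IsWeakGradient v G) (hv : MemLp v 2 volume)
    (hGL : ∀ i, MemLp (fun x => G x i) 2 volume) (hc : HasCompactSupport v) :
    ∫ x, ∑ i, F x i * G x i = -∫ x, f x * v x := by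
  have ch : Continuous fun y => ∑ i, ∫ x, F x i * G (x - y) i :=
    continuous_finsetSum _ fun i _ => continuous_integral_mul_translate (hF i) (hGL i)
  have ck : Continuous fun y => -∫ x, f x * v (x - y) :=
    (continuous_integral_mul_translate hf hv).neg
  have key : (fun y => ∑ i, ∫ x, F x i * G (x - y) i) =ᵐ[volume]
      fun y => -∫ x, f x * v (x - y) := by
    refine ae_eq_of_test ch.locallyIntegrable ck.locallyIntegrable fun ρ hρ => ?_
    have hi := fun i => integral_mul_translate_smul (hF i) (hGL i) hρ.smooth.continuous hρ.compact
    have hj := integral_mul_translate_smul hf hv hρ.smooth.continuous hρ.compact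
    simp only [Finset.smul_sum, smul_neg]
    rw [integral_finsetSum _ fun i _ => hρ.integrable_smul
      (continuous_integral_mul_translate (hF i) (hGL i)).locallyIntegrable, integral_neg, hj.2]
    simp only [(hi _).2]
    rw [← integral_finsetSum _ fun i _ => (hi i).1]
    have hcv := h.eq_complex (hρ.compact.contDiff_convolution_left (μ := volume)
      (ContinuousLinearMap.lsmul ℝ ℝ : ℝ →L[ℝ] ℂ →L[ℝ] ℂ) hρ.smooth hG.locInt)
      (hρ.compact.convolution _ hc)
    simp only [hG.fderiv_convolution hρ] at hcv
    exact hcv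
  have e := congrFun ((Continuous.ae_eq_iff_eq volume ch ck).1 key) 0
  simp only [sub_zero] at e
  rwa [integral_finsetSum (f := fun i x => F x i * G x i) _
    fun i _ => (hF i).integrable_mul (hGL i)]

/-! ### Testing against `θ w̄` with bounded `θ` -/

theorem memLp_bounded_smul {θ : R3 → ℝ} (hθ : Continuous θ) {C : ℝ} (hC : ∀ x, |θ x| ≤ C)
    {f : R3 → ℂ} (hf : MemLp f 2 volume) : MemLp (fun x => θ x • f x) 2 volume :=
  hf.of_le_mul (c := C) (hθ.aestronglyMeasurable.smul hf.1) (.of_forall fun x => by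
    rw [norm_smul]
    exact mul_le_mul_of_nonneg_right (hC x) (norm_nonneg _))

theorem abs_partialDeriv_le (θ : R3 → ℝ) (i : Fin 3) (x : R3) :
    |partialDeriv i θ x| ≤ ‖fderiv ℝ θ x‖ := by
  simpa [partialDeriv] using (fderiv ℝ θ x).le_opNorm (EuclideanSpace.single i 1)

/-- The integrand obtained by testing `div F = f` against `θ w̄`. -/
noncomputable def energyIntegrand (F G : R3 → C3) (w : R3 → ℂ) (θ : R3 → ℝ) (x : R3) : ℂ :=
  ∑ i, F x i * (θ x • conj (G x i) + partialDeriv i θ x • conj (w x))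

theorem integrable_energyIntegrand {θ : R3 → ℝ} (hθ : ContDiff ℝ ∞ θ) {A B : ℝ}
    (hA : ∀ x, |θ x| ≤ A) (hB : ∀ i x, |partialDeriv i θ x| ≤ B) {F G : R3 → C3} {w : R3 → ℂ}
    (hF : ∀ i, MemLp (fun x => F x i) 2 volume) (hw : MemLp w 2 volume)
    (hGL : ∀ i, MemLp (fun x => G x i) 2 volume) : Integrable (energyIntegrand F G w θ) :=
  integrable_finsetSum _ fun i _ => (hF i).integrable_mul
    ((memLp_bounded_smul hθ.continuous hA (hGL i).star).add
      (memLp_bounded_smul (continuous_partialDeriv hθ i) (hB i) hw.star))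

theorem IsTest.integral_energyIntegrand {θ : R3 → ℝ} (hθ : IsTest θ) {F G : R3 → C3}
    {f w : R3 → ℂ} (h : IsWeakDivergence F f)
    (hF : ∀ i, MemLp (fun x => F x i) 2 volume) (hf : MemLp f 2 volume)
    (hG : IsWeakGradient w G) (hw : MemLp w 2 volume)
    (hGL : ∀ i, MemLp (fun x => G x i) 2 volume) :
    ∫ x, energyIntegrand F G w θ x = -∫ x, f x * (θ x • conj (w x)) := by
  obtain ⟨C, hC⟩ := hθ.compact.exists_bound_of_continuous hθ.smooth.continuous
  have hD : ∀ i, ∃ D, ∀ x, |partialDeriv i θ x| ≤ D := fun i =>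
    (hθ.compact.fderiv_apply ℝ (EuclideanSpace.single i 1)).exists_bound_of_continuous
      (continuous_partialDeriv hθ.smooth i)
  choose D hD using hD
  have := h.integral_mul_grad hF hf (hG.conj.smooth_smul hθ.smooth)
    (memLp_bounded_smul hθ.smooth.continuous hC hw.star)
    (fun i => (memLp_bounded_smul hθ.smooth.continuous hC (hGL i).star).add
      (memLp_bounded_smul (continuous_partialDeriv hθ.smooth i) (hD i) hw.star))
    hθ.compact.smul_right
  simpa [energyIntegrand, productGrad] using this

/-- A family of test functions tending to `1`, with gradients tending to `0` uniformly. -/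
theorem exists_cutoff : ∃ (χ : ℕ → R3 → ℝ) (C : ℝ), (∀ n, IsTest (χ n)) ∧
    (∀ n x, 0 ≤ χ n x ∧ χ n x ≤ 1) ∧ (∀ n i x, |partialDeriv i (χ n) x| ≤ C / (n + 1)) ∧
    ∀ x, ∀ᶠ n in Filter.atTop, χ n x = 1 := by
  let b : ContDiffBump (0 : R3) := ⟨1, 2, one_pos, one_lt_two⟩
  have hb : ContDiff ℝ ∞ b := b.contDiff
  obtain ⟨C, hC⟩ := (b.hasCompactSupport.fderiv (𝕜 := ℝ)).exists_bound_of_continuous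
    (hb.continuous_fderiv (by simp))
  have hpos : ∀ n : ℕ, (0 : ℝ) < n + 1 := fun n => by positivity
  refine ⟨fun n x => b (((n : ℝ) + 1)⁻¹ • x), C, fun n => ⟨hb.comp (contDiff_const_smul _), ?_⟩,
    fun n x => ⟨b.nonneg, b.le_one⟩, fun n i x => ?_, fun x => ?_⟩
  · exact b.hasCompactSupport.comp_homeomorph
      (Homeomorph.smulOfNeZero (((n : ℝ) + 1)⁻¹) (inv_ne_zero (hpos n).ne'))
  · have h1 : HasFDerivAt b (fderiv ℝ b (((n : ℝ) + 1)⁻¹ • x)) (((n : ℝ) + 1)⁻¹ • x) :=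
      (hb.contDiffAt.differentiableAt (by simp)).hasFDerivAt
    have h2 := h1.comp x ((hasFDerivAt_id x).const_smul ((n : ℝ) + 1)⁻¹)
    have h3 : fderiv ℝ (fun x => b (((n : ℝ) + 1)⁻¹ • x)) x = _ := h2.fderiv
    have h4 := (fderiv ℝ b (((n : ℝ) + 1)⁻¹ • x)).le_opNorm (EuclideanSpace.single i 1)
    have h5 := hC (((n : ℝ) + 1)⁻¹ • x)
    simp only [PiLp.norm_single, norm_one, mul_one, Real.norm_eq_abs] at h4
    simp only [partialDeriv, h3, ContinuousLinearMap.comp_apply, smul_apply,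
      ContinuousLinearMap.id_apply, map_smul, smul_eq_mul, abs_mul]
    rw [abs_of_pos (inv_pos.2 (hpos n)), div_eq_inv_mul]
    exact mul_le_mul_of_nonneg_left (h4.trans h5) (inv_pos.2 (hpos n)).le
  · obtain ⟨N, hN⟩ := exists_nat_ge ‖x‖
    filter_upwards [Filter.eventually_ge_atTop N] with n hn
    refine b.one_of_mem_closedBall ?_
    rw [mem_closedBall_zero_iff, norm_smul, norm_inv, Real.norm_eq_abs, abs_of_pos (hpos n),
      inv_mul_le_iff₀ (hpos n)]
    have : (N : ℝ) ≤ n := by exact_mod_cast hn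
    change ‖x‖ ≤ (n + 1) * 1
    linarith

/-- Replace `θ` by `χₙθ` and let `n → ∞` by dominated convergence; the extra term with `∂χₙ`
vanishes in the limit. -/
theorem integral_energyIntegrand {θ : R3 → ℝ} (hθ : ContDiff ℝ ∞ θ) {A B : ℝ}
    (hA : ∀ x, |θ x| ≤ A) (hB : ∀ i x, |partialDeriv i θ x| ≤ B) {F G : R3 → C3}
    {f w : R3 → ℂ} (h : IsWeakDivergence F f)
    (hF : ∀ i, MemLp (fun x => F x i) 2 volume) (hf : MemLp f 2 volume)
    (hG : IsWeakGradient w G) (hw : MemLp w 2 volume)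
    (hGL : ∀ i, MemLp (fun x => G x i) 2 volume) :
    ∫ x, energyIntegrand F G w θ x = -∫ x, f x * (θ x • conj (w x)) := by
  obtain ⟨χ, C, hχ, hχ1, hχC, hχt⟩ := exists_cutoff
  have hA0 : 0 ≤ A := (abs_nonneg _).trans (hA 0)
  have hC0 : 0 ≤ C := by simpa using (abs_nonneg _).trans (hχC 0 0 0)
  have hCn : ∀ n i x, |partialDeriv i (χ n) x| ≤ C := fun n i x =>
    (hχC n i x).trans (div_le_self hC0 (by simp))
  have habs : ∀ n x, |χ n x| ≤ 1 := fun n x => abs_le.2 ⟨by linarith [(hχ1 n x).1], (hχ1 n x).2⟩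
  have hθn : ∀ n, IsTest fun x => χ n x * θ x := fun n => (hχ n).mul_smooth hθ
  have hp0 : ∀ i x, Filter.Tendsto (fun n => partialDeriv i (χ n) x) Filter.atTop (nhds 0) :=
    fun i x => by
      refine squeeze_zero_norm (fun n => hχC n i x) ?_
      simpa [Function.comp_def] using
        (tendsto_const_div_atTop_nhds_zero_nat C).comp (Filter.tendsto_add_atTop_nat 1)
  have hp1 : ∀ x, Filter.Tendsto (fun n => χ n x) Filter.atTop (nhds 1) := fun x =>
    tendsto_const_nhds.congr' ((hχt x).mono fun n hn => hn.symm)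
  have hFG : ∀ i, Integrable (fun x => ‖F x i‖ * ‖G x i‖) := fun i =>
    (hF i).norm.integrable_mul (hGL i).norm
  have hFw : ∀ i, Integrable (fun x => ‖F x i‖ * ‖w x‖) := fun i =>
    (hF i).norm.integrable_mul hw.norm
  have lim1 : Filter.Tendsto (fun n => ∫ x, energyIntegrand F G w (fun x => χ n x * θ x) x)
      Filter.atTop (nhds (∫ x, energyIntegrand F G w θ x)) := by
    -- `C * A + B` bounds `∂(χₙθ)` by Leibniz, uniformly in `n`.
    refine tendsto_integral_of_dominated_convergence
      (fun x => ∑ i, (A * (‖F x i‖ * ‖G x i‖) + (C * A + B) * (‖F x i‖ * ‖w x‖)))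
      (fun n => ?_) ?_ (fun n => .of_forall fun x => ?_) (.of_forall fun x => ?_)
    · unfold energyIntegrand
      refine Finset.aestronglyMeasurable_fun_sum _ fun i _ => (hF i).1.mul ?_
      exact ((hθn n).smooth.continuous.aestronglyMeasurable.smul (hGL i).star.1).add
        ((continuous_partialDeriv (hθn n).smooth i).aestronglyMeasurable.smul hw.star.1)
    · exact integrable_finsetSum _ fun i _ => ((hFG i).const_mul _).add ((hFw i).const_mul _)
    · refine (norm_sum_le _ _).trans (Finset.sum_le_sum fun i _ => ?_)
      rw [norm_mul]
      have e1 : |χ n x * θ x| ≤ A := by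
        rw [abs_mul]
        exact (mul_le_mul (habs n x) (hA x) (abs_nonneg _) zero_le_one).trans (one_mul A).le
      have e2 : |partialDeriv i (fun x => χ n x * θ x) x| ≤ C * A + B := by
        rw [partialDeriv_mul (hχ n).smooth hθ]
        refine (abs_add_le _ _).trans ?_
        rw [abs_mul, abs_mul]
        exact add_le_add (mul_le_mul (hCn n i x) (hA x) (abs_nonneg _) hC0)
          ((mul_le_mul (habs n x) (hB i x) (abs_nonneg _) zero_le_one).trans (one_mul B).le)
      calc _ ≤ ‖F x i‖ * (A * ‖G x i‖ + (C * A + B) * ‖w x‖) := by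
            refine mul_le_mul_of_nonneg_left ((norm_add_le _ _).trans ?_) (norm_nonneg _)
            rw [norm_smul, norm_smul, RCLike.norm_conj, RCLike.norm_conj]
            exact add_le_add (mul_le_mul_of_nonneg_right e1 (norm_nonneg _))
              (mul_le_mul_of_nonneg_right e2 (norm_nonneg _))
        _ = _ := by ring
    · refine tendsto_finsetSum _ fun i _ => tendsto_const_nhds.mul (.add ?_ ?_)
      · refine Filter.Tendsto.smul_const ?_ _
        simpa using (hp1 x).mul_const (θ x)
      · refine Filter.Tendsto.smul_const ?_ _
        simp only [partialDeriv_mul (hχ _).smooth hθ]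
        simpa using ((hp0 i x).mul_const (θ x)).add ((hp1 x).mul_const (partialDeriv i θ x))
  have lim2 : Filter.Tendsto (fun n => -∫ x, f x * ((χ n x * θ x) • conj (w x)))
      Filter.atTop (nhds (-∫ x, f x * (θ x • conj (w x)))) := by
    refine (tendsto_integral_of_dominated_convergence
      (fun x => A * (‖f x‖ * ‖w x‖))
      (fun n => ?_) ?_ (fun n => .of_forall fun x => ?_) (.of_forall fun x => ?_)).neg
    · exact hf.1.mul ((hθn n).smooth.continuous.aestronglyMeasurable.smul hw.star.1)
    · exact (hf.norm.integrable_mul hw.norm).const_mul _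
    · have e1 : |χ n x * θ x| ≤ A := by
        rw [abs_mul]
        exact (mul_le_mul (habs n x) (hA x) (abs_nonneg _) zero_le_one).trans (one_mul A).le
      rw [norm_mul, norm_smul, RCLike.norm_conj, Real.norm_eq_abs]
      calc _ ≤ ‖f x‖ * (A * ‖w x‖) := by gcongr
        _ = _ := by ring
    · refine tendsto_const_nhds.mul (Filter.Tendsto.smul_const ?_ _)
      simpa using (hp1 x).mul_const (θ x)
  refine tendsto_nhds_unique lim1 (lim2.congr fun n => ?_)
  exact ((hθn n).integral_energyIntegrand h hF hf hG hw hGL).symm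

/-! ### Gradient bounds and exponential weights -/

/-- Cauchy–Schwarz, after Riesz turns the differential into a vector. The constant 1 matters: a
dimensional factor would use up the margin in the energy estimate. -/
theorem norm_sum_mul_partialDeriv_le (η : R3 → ℝ) (x : R3) (z : C3) :
    ‖∑ i, z i * (partialDeriv i η x : ℂ)‖ ≤ ‖z‖ * ‖fderiv ℝ η x‖ := by
  set g : R3 := (InnerProductSpace.toDual ℝ R3).symm (fderiv ℝ η x)
  have hgi : ∀ i, partialDeriv i η x = g i := fun i => by
    have : inner ℝ g (EuclideanSpace.single i (1 : ℝ)) = partialDeriv i η x :=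
      InnerProductSpace.toDual_symm_apply
    rw [← this, EuclideanSpace.inner_single_right]
    simp
  have hn : ‖g‖ = ‖fderiv ℝ η x‖ := LinearIsometryEquiv.norm_map _ _
  rw [← hn, EuclideanSpace.norm_eq, EuclideanSpace.norm_eq]
  refine (norm_sum_le _ _).trans ?_
  refine le_trans (Finset.sum_le_sum fun i _ => ?_)
    (Real.sum_mul_le_sqrt_mul_sqrt Finset.univ (fun i => ‖z i‖) fun i => ‖g i‖)
  rw [norm_mul, Complex.norm_real, hgi]

theorem hasFDerivAt_sqrt_one_add_norm_sq (x : R3) :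
    ∃ D : R3 →L[ℝ] ℝ, HasFDerivAt (fun y : R3 => Real.sqrt (1 + ‖y‖ ^ 2)) D x ∧ ‖D‖ ≤ 1 := by
  have hp : 0 < 1 + ‖x‖ ^ 2 := by positivity
  have h := (((hasStrictFDerivAt_norm_sq x).hasFDerivAt).const_add 1).sqrt hp.ne'
  refine ⟨_, h, ?_⟩
  have hs : 0 < Real.sqrt (1 + ‖x‖ ^ 2) := Real.sqrt_pos.2 hp
  have hx : ‖x‖ ≤ Real.sqrt (1 + ‖x‖ ^ 2) := Real.le_sqrt_of_sq_le (by linarith)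
  refine ContinuousLinearMap.opNorm_le_bound _ zero_le_one fun y => ?_
  have e : ((1 / (2 * Real.sqrt (1 + ‖x‖ ^ 2))) • (2 • innerSL ℝ x)) y =
      inner ℝ x y / Real.sqrt (1 + ‖x‖ ^ 2) := by
    simp
    field_simp
  rw [e, Real.norm_eq_abs, abs_div, abs_of_pos hs, one_mul, div_le_iff₀ hs]
  calc |inner ℝ x y| ≤ ‖x‖ * ‖y‖ := abs_real_inner_le_norm x y
    _ ≤ ‖y‖ * Real.sqrt (1 + ‖x‖ ^ 2) := by
      rw [mul_comm]
      exact mul_le_mul_of_nonneg_left hx (norm_nonneg _)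

/-- A smooth bounded substitute of `exp (a |x|)`, which increases to `exp (a √(1 + |x|²))` as
`δ` tends to `0`. -/
noncomputable def expWeight (a δ : ℝ) (x : R3) : ℝ :=
  Real.exp (a * (Real.sqrt (1 + ‖x‖ ^ 2) / (1 + δ * Real.sqrt (1 + ‖x‖ ^ 2))))

theorem contDiff_expWeight (a : ℝ) {δ : ℝ} (hδ : 0 ≤ δ) : ContDiff ℝ ∞ (expWeight a δ) := by
  have hs : ContDiff ℝ ∞ fun x : R3 => Real.sqrt (1 + ‖x‖ ^ 2) :=
    (contDiff_const.add (contDiff_norm_sq ℝ)).sqrt fun x => by positivity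
  exact Real.contDiff_exp.comp (contDiff_const.mul (hs.div (contDiff_const.add
    (contDiff_const.mul hs)) fun x => by positivity))

/-- `t ↦ t / (1 + δt)` has derivative `(1 + δt)⁻²`, in `[0, 1]`, and `√(1 + |x|²)` is 1-Lipschitz.
The bound thus has no loss as `δ → 0`. -/
theorem norm_fderiv_expWeight_le {a δ : ℝ} (ha : 0 ≤ a) (hδ : 0 ≤ δ) (x : R3) :
    ‖fderiv ℝ (expWeight a δ) x‖ ≤ a * expWeight a δ x := by
  obtain ⟨D, hD, hD1⟩ := hasFDerivAt_sqrt_one_add_norm_sq x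
  set s := Real.sqrt (1 + ‖x‖ ^ 2) with hs
  have hs0 : 0 ≤ s := Real.sqrt_nonneg _
  have hp : 0 < 1 + δ * s := by positivity
  have h1 : HasDerivAt (fun t : ℝ => Real.exp (a * (t / (1 + δ * t))))
      (Real.exp (a * (s / (1 + δ * s))) *
        (a * ((1 * (1 + δ * s) - s * (δ * 1)) / (1 + δ * s) ^ 2))) s :=
    (((hasDerivAt_id s).div (((hasDerivAt_id s).const_mul δ).const_add 1) hp.ne').const_mul a).exp
  have h2 := h1.comp_hasFDerivAt x hD
  have h2' : fderiv ℝ (expWeight a δ) x = _ := h2.fderiv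
  rw [h2', norm_smul]
  have h3 : (1 * (1 + δ * s) - s * (δ * 1)) / (1 + δ * s) ^ 2 ≤ 1 := by
    rw [div_le_one (by positivity)]
    nlinarith [mul_nonneg hδ hs0]
  have h4 : 0 ≤ (1 * (1 + δ * s) - s * (δ * 1)) / (1 + δ * s) ^ 2 :=
    div_nonneg (by linarith) (by positivity)
  rw [Real.norm_eq_abs, abs_of_nonneg (by positivity)]
  calc _ ≤ Real.exp (a * (s / (1 + δ * s))) * (a * 1) * 1 := by gcongr
    _ = _ := by rw [expWeight]; ring

theorem expWeight_le {a δ : ℝ} (ha : 0 ≤ a) (hδ : 0 ≤ δ) (x : R3) :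
    expWeight a δ x ≤ Real.exp (a * Real.sqrt (1 + ‖x‖ ^ 2)) := by
  refine Real.exp_le_exp.2 (mul_le_mul_of_nonneg_left (div_le_self (Real.sqrt_nonneg _) ?_) ha)
  have : 0 ≤ δ * Real.sqrt (1 + ‖x‖ ^ 2) := by positivity
  linarith

theorem expWeight_le_of_pos {a δ : ℝ} (ha : 0 ≤ a) (hδ : 0 < δ) (x : R3) :
    expWeight a δ x ≤ Real.exp (a * δ⁻¹) := by
  refine Real.exp_le_exp.2 (mul_le_mul_of_nonneg_left ?_ ha)
  rw [div_le_iff₀ (by positivity), mul_add, inv_mul_cancel_left₀ hδ.ne', mul_one]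
  have : 0 < δ⁻¹ := inv_pos.2 hδ
  linarith

/-- Smooth bounded weights, vanishing on `ball 0 R`, whose limit grows like `exp (a |x|)`. -/
theorem exists_weights {a R : ℝ} (ha : 0 ≤ a) (hR : 0 < R) :
    ∃ (η : ℕ → R3 → ℝ) (η' : R3 → ℝ) (K C : ℝ), 0 ≤ K ∧ 0 ≤ C ∧
      (∀ n, ContDiff ℝ ∞ (η n)) ∧ (∀ n, ∃ A, ∀ x, |η n x| ≤ A) ∧
      (∀ n, ∀ x ∈ Metric.ball (0 : R3) R, η n x = 0) ∧
      (∀ n x, ‖fderiv ℝ (η n) x‖ ^ 2 ≤ a ^ 2 * η n x ^ 2 + K) ∧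
      (∀ x, Filter.Tendsto (fun n => η n x) Filter.atTop (nhds (η' x))) ∧
      ∀ x, Real.exp (2 * a * ‖x‖) ≤ η' x ^ 2 + C := by
  let b : ContDiffBump (0 : R3) := ⟨R, 2 * R, hR, by linarith⟩
  have hb : ContDiff ℝ ∞ b := b.contDiff
  obtain ⟨L, hL⟩ := (b.hasCompactSupport.fderiv (𝕜 := ℝ)).exists_bound_of_continuous
    (hb.continuous_fderiv (by simp))
  have hL0 : 0 ≤ L := (norm_nonneg _).trans (hL 0)
  have hζ : ContDiff ℝ ∞ fun x => 1 - b x := contDiff_const.sub hb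
  have hζ1 : ∀ x, |1 - b x| ≤ 1 := fun x =>
    abs_le.2 ⟨by linarith [b.le_one (x := x)], by linarith [b.nonneg (x := x)]⟩
  let δ : ℕ → ℝ := fun n => 1 / (n + 1)
  have hδ : ∀ n, 0 < δ n := fun n => by positivity
  have hδ0 : Filter.Tendsto δ Filter.atTop (nhds 0) := tendsto_one_div_add_atTop_nhds_zero_nat
  have hE0 : ∀ n x, 0 < expWeight a (δ n) x := fun n x => Real.exp_pos _
  -- Bounds the gradient of the weight on `|x| ≤ 2R`, where the cutoff varies, independently of `n`.
  set M : ℝ := (a + L) * Real.exp (a * Real.sqrt (1 + (2 * R) ^ 2))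
  refine ⟨fun n x => (1 - b x) * expWeight a (δ n) x,
    fun x => (1 - b x) * expWeight a 0 x, M ^ 2, Real.exp (2 * a * (2 * R)), sq_nonneg _,
    (Real.exp_pos _).le, fun n => hζ.mul (contDiff_expWeight a (hδ n).le), fun n =>
      ⟨Real.exp (a * (δ n)⁻¹), fun x => ?_⟩, fun n x hx => ?_, fun n x => ?_, fun x => ?_,
    fun x => ?_⟩
  · rw [abs_mul, abs_of_pos (hE0 n x)]
    calc _ ≤ 1 * Real.exp (a * (δ n)⁻¹) :=
          mul_le_mul (hζ1 x) (expWeight_le_of_pos ha (hδ n) x) (hE0 n x).le zero_le_one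
      _ = _ := one_mul _
  · have : b x = 1 := b.one_of_mem_closedBall (Metric.ball_subset_closedBall hx)
    simp [this]
  · have hd1 : HasFDerivAt (fun x => 1 - b x) (-fderiv ℝ b x) x :=
      ((hb.contDiffAt.differentiableAt (by simp)).hasFDerivAt).const_sub 1
    have hd2 : HasFDerivAt (expWeight a (δ n)) (fderiv ℝ (expWeight a (δ n)) x) x :=
      ((contDiff_expWeight a (hδ n).le).contDiffAt.differentiableAt (by simp)).hasFDerivAt
    have hd : fderiv ℝ (fun x => (1 - b x) * expWeight a (δ n) x) x = _ := (hd1.mul hd2).fderiv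
    beta_reduce
    rw [hd]
    have hN := norm_fderiv_expWeight_le ha (hδ n).le x
    have h1 : ‖(1 - b x) • fderiv ℝ (expWeight a (δ n)) x‖ ≤
        a * (|1 - b x| * expWeight a (δ n) x) := by
      rw [norm_smul, Real.norm_eq_abs]
      calc _ ≤ |1 - b x| * (a * expWeight a (δ n) x) := by gcongr
        _ = _ := by ring
    rcases le_or_gt ‖x‖ (2 * R) with hx | hx
    · refine le_add_of_nonneg_of_le (by positivity) (pow_le_pow_left₀ (norm_nonneg _) ?_ 2)
      have hE : expWeight a (δ n) x ≤ Real.exp (a * Real.sqrt (1 + (2 * R) ^ 2)) :=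
        (expWeight_le ha (hδ n).le x).trans (Real.exp_le_exp.2 (by gcongr))
      refine (norm_add_le _ _).trans ?_
      calc _ ≤ a * (1 * expWeight a (δ n) x) + expWeight a (δ n) x * L := by
            refine add_le_add (h1.trans ?_) ?_
            · exact mul_le_mul_of_nonneg_left
                (mul_le_mul_of_nonneg_right (hζ1 x) (hE0 n x).le) ha
            · rw [norm_smul, Real.norm_eq_abs, abs_of_pos (hE0 n x), norm_neg]
              exact mul_le_mul_of_nonneg_left (hL x) (hE0 n x).le
        _ = (a + L) * expWeight a (δ n) x := by ring
        _ ≤ M := mul_le_mul_of_nonneg_left hE (by positivity)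
    · have hb0 : b =ᶠ[nhds x] fun _ => 0 := by
        filter_upwards [(isOpen_lt continuous_const continuous_norm).mem_nhds hx] with y hy
        exact b.zero_of_le_dist (by simpa using le_of_lt hy)
      have hf0 : fderiv ℝ b x = 0 := by
        rw [hb0.fderiv_eq]
        simp
      refine le_add_of_le_of_nonneg ?_ (sq_nonneg _)
      rw [hf0, neg_zero, smul_zero, add_zero, ← mul_pow]
      refine (pow_le_pow_left₀ (norm_nonneg _) h1 2).trans (le_of_eq ?_)
      rw [mul_pow, mul_pow, sq_abs, mul_pow, mul_pow]
  · refine tendsto_const_nhds.mul ?_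
    have hc : Continuous fun t : ℝ => 1 + t * Real.sqrt (1 + ‖x‖ ^ 2) := by fun_prop
    have ht := (hc.tendsto 0).comp hδ0
    have hne : (1 + 0 * Real.sqrt (1 + ‖x‖ ^ 2)) ≠ 0 := by simp
    exact (Real.continuous_exp.tendsto _).comp
      (tendsto_const_nhds.mul (tendsto_const_nhds.div ht hne))
  · rcases le_or_gt ‖x‖ (2 * R) with hx | hx
    · refine le_add_of_nonneg_of_le (sq_nonneg _) (Real.exp_le_exp.2 ?_)
      gcongr
    · refine le_add_of_le_of_nonneg ?_ (Real.exp_pos _).le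
      have : b x = 0 := b.zero_of_le_dist (by simpa using hx.le)
      beta_reduce
      rw [this, sub_zero, one_mul, expWeight, ← Real.exp_nat_mul]
      refine Real.exp_le_exp.2 ?_
      have hs : ‖x‖ ≤ Real.sqrt (1 + ‖x‖ ^ 2) := Real.le_sqrt_of_sq_le (by linarith)
      have := mul_le_mul_of_nonneg_left hs ha
      simp
      linarith

/-! ### The eigenvalue equation in weak form -/

theorem measurable_sigmaInf (Ξ : Set R3) (σm σp : ℝ) : Measurable (sigmaInf Ξ σm σp) :=
  Measurable.ite isClosed_closure.measurableSet measurable_const measurable_const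

theorem abs_sigmaInf_le (Ξ : Set R3) (σm σp : ℝ) (x : R3) :
    |sigmaInf Ξ σm σp x| ≤ max |σm| |σp| := by
  unfold sigmaInf
  split_ifs
  · exact le_max_left _ _
  · exact le_max_right _ _

theorem memLp_apply (G : L2Vec) (i : Fin 3) : MemLp (fun x => G x i) 2 volume := by
  have h := Lp.memLp G
  exact h.of_le ((PiLp.continuous_apply 2 _ i).comp_aestronglyMeasurable h.1)
    (.of_forall fun x => PiLp.norm_apply_le _ i)

theorem memLp_flux (Ξ : Set R3) (σm σp : ℝ) (w : H1) (i : Fin 3) :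
    MemLp (fun x => flux Ξ σm σp w x i) 2 volume := by
  have h := memLp_apply (grad w) i
  have hm : AEStronglyMeasurable (fun x => (sigmaInf Ξ σm σp x : ℂ)) volume :=
    (Complex.measurable_ofReal.comp (measurable_sigmaInf Ξ σm σp)).aestronglyMeasurable
  refine h.of_le_mul (c := max |σm| |σp|) (hm.mul h.1) (.of_forall fun x => ?_)
  rw [flux, PiLp.smul_apply, norm_smul, Complex.norm_real]
  exact mul_le_mul_of_nonneg_right (abs_sigmaInf_le Ξ σm σp x) (norm_nonneg _)

theorem IsEigenfunction.divFlux_eq {Ξ : Set R3} {σm σp : ℝ} {μ : ℂ}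
    {w : (nearField Ξ σm σp).domain} (hw : IsEigenfunction (nearField Ξ σm σp) μ w) :
    divFlux Ξ σm σp w = (-μ) • (w : L2) := by
  have h : -divFlux Ξ σm σp w = μ • (w : L2) := hw.2
  rw [neg_smul, ← h, neg_neg]

/-- The weak formulation of `B^∞ w = μ w`, tested against `θ w̄`. -/
theorem IsEigenfunction.integral_energyIntegrand {Ξ : Set R3} {σm σp : ℝ} {μ : ℂ}
    {w : (nearField Ξ σm σp).domain} (hw : IsEigenfunction (nearField Ξ σm σp) μ w)
    {θ : R3 → ℝ} (hθ : ContDiff ℝ ∞ θ) {A B : ℝ} (hA : ∀ x, |θ x| ≤ A)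
    (hB : ∀ i x, |partialDeriv i θ x| ≤ B) :
    ∫ x, energyIntegrand (flux Ξ σm σp (toH1 w)) (grad (toH1 w)) (w : L2) θ x =
      μ * ((∫ x, θ x * ‖(w : L2) x‖ ^ 2 : ℝ) : ℂ) := by
  refine (_root_.integral_energyIntegrand (w := (w : L2)) hθ hA hB (isWeakDivergence_divFlux w)
    (memLp_flux Ξ σm σp (toH1 w)) (Lp.memLp _) (isWeakGradient_grad (toH1 w)) (Lp.memLp (w : L2))
    (memLp_apply (grad (toH1 w)))).trans ?_
  rw [← integral_neg, ← integral_complex_ofReal, ← integral_const_mul]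
  refine integral_congr_ae ?_
  rw [hw.divFlux_eq]
  filter_upwards [Lp.coeFn_smul (-μ) (w : L2)] with x hx
  rw [hx, Pi.smul_apply, smul_eq_mul, Complex.real_smul]
  push_cast
  rw [← Complex.mul_conj']
  ring

theorem integrable_norm_sq (w : L2) : Integrable fun x => ‖w x‖ ^ 2 :=
  (memLp_two_iff_integrable_sq_norm (Lp.memLp w).1).1 (Lp.memLp w)

theorem integrable_norm_sq_vec (G : L2Vec) : Integrable fun x => ‖G x‖ ^ 2 :=
  (memLp_two_iff_integrable_sq_norm (Lp.memLp G).1).1 (Lp.memLp G)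

theorem integral_norm_sq_eq_one {w : L2} (hw : ‖w‖ = 1) : ∫ x, ‖w x‖ ^ 2 = 1 := by
  have h : inner ℂ w w = ((∫ x, ‖w x‖ ^ 2 : ℝ) : ℂ) := by
    rw [L2.inner_def, ← integral_complex_ofReal]
    simp
  rw [inner_self_eq_norm_sq_to_K, hw] at h
  have h' : (1 : ℂ) = ((∫ x, ‖w x‖ ^ 2 : ℝ) : ℂ) := by simpa using h
  exact_mod_cast h'.symm

theorem sum_mul_conj_eq (z : C3) : ∑ i, z i * conj (z i) = ((‖z‖ ^ 2 : ℝ) : ℂ) := by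
  simp [EuclideanSpace.norm_sq_eq, Complex.mul_conj']

/-- Eigenvalues outside `[0, ∞)` are real and negative. -/
theorem IsEigenfunction.exists_neg {Ξ : Set R3} {σm σp : ℝ} {μ : ℂ}
    {w : (nearField Ξ σm σp).domain} (hw : IsEigenfunction (nearField Ξ σm σp) μ w)
    (hμ : μ ∉ Complex.ofReal '' Set.Ici (0 : ℝ)) (hnorm : ‖(w : L2)‖ = 1) :
    ∃ m : ℝ, m < 0 ∧ μ = m := by
  have h0 : ∀ i x, partialDeriv i (fun _ => 1) x = 0 := fun i x => by simp [partialDeriv]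
  -- With `θ = 1` and `‖w‖ = 1` the identity reads `∫ σ|∇w|² = μ`, so `μ` is real.
  have e := hw.integral_energyIntegrand (θ := fun _ => 1) (A := 1) (B := 0) contDiff_const
    (by simp) (by simp [h0])
  simp only [one_mul, integral_norm_sq_eq_one hnorm, Complex.ofReal_one, mul_one] at e
  have h : ∀ x, energyIntegrand (flux Ξ σm σp (toH1 w)) (grad (toH1 w)) (w : L2) (fun _ => 1) x =
      ((sigmaInf Ξ σm σp x * ‖grad (toH1 w) x‖ ^ 2 : ℝ) : ℂ) := fun x => by
    rw [Complex.ofReal_mul, ← sum_mul_conj_eq, Finset.mul_sum]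
    simp [energyIntegrand, flux, h0, mul_assoc]
  simp only [h] at e
  rw [integral_complex_ofReal] at e
  refine ⟨_, ?_, e.symm⟩
  by_contra! hn
  exact hμ ⟨_, hn, e⟩

/-! ### Agmon's estimate -/

theorem energyIntegrand_flux (Ξ : Set R3) (σm σp : ℝ) (w : H1) (η : R3 → ℝ)
    (hη : ContDiff ℝ ∞ η) (x : R3) :
    energyIntegrand (flux Ξ σm σp w) (grad w) (w : L2) (fun y => η y * η y) x =
      sigmaInf Ξ σm σp x * ((η x ^ 2 * ‖grad w x‖ ^ 2 : ℝ) +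
        2 * η x * conj ((w : L2) x) * ∑ i, grad w x i * (partialDeriv i η x : ℂ)) := by
  rw [Complex.ofReal_mul, ← sum_mul_conj_eq, Finset.mul_sum, Finset.mul_sum,
    ← Finset.sum_add_distrib, Finset.mul_sum]
  refine Finset.sum_congr rfl fun i _ => ?_
  rw [partialDeriv_mul hη hη, flux, PiLp.smul_apply, smul_eq_mul, Complex.real_smul,
    Complex.real_smul]
  push_cast
  ring

/-- Pointwise lower bound in the weighted energy estimate. -/
theorem le_re_energyIntegrand {Ξ : Set R3} {σm σp : ℝ} (hσp : 0 < σp) (w : H1) {η : R3 → ℝ}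
    (hη : ContDiff ℝ ∞ η) {R : ℝ} (hR : closure Ξ ⊆ Metric.ball 0 R)
    (h0 : ∀ x ∈ Metric.ball (0 : R3) R, η x = 0) {a K : ℝ} (hK : 0 ≤ K)
    (hD : ∀ x, ‖fderiv ℝ η x‖ ^ 2 ≤ a ^ 2 * η x ^ 2 + K) (x : R3) :
    σp * (1 / 2 * (η x ^ 2 * ‖grad w x‖ ^ 2) - 2 * a ^ 2 * (η x ^ 2 * ‖(w : L2) x‖ ^ 2)
      - 2 * K * ‖(w : L2) x‖ ^ 2) ≤
    (energyIntegrand (flux Ξ σm σp w) (grad w) (w : L2) (fun y => η y * η y) x).re := by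
  rw [energyIntegrand_flux Ξ σm σp w η hη]
  -- In the inclusion `η = 0`: the right side vanishes and the left side is nonpositive.
  by_cases hx : x ∈ closure Ξ
  · simp only [h0 x (hR hx)]
    have : 0 ≤ 2 * K * ‖(w : L2) x‖ ^ 2 := by positivity
    simp
    nlinarith
  · have hs : sigmaInf Ξ σm σp x = σp := if_neg hx
    rw [hs, Complex.re_ofReal_mul, Complex.add_re, Complex.ofReal_re]
    refine mul_le_mul_of_nonneg_left ?_ hσp.le
    have h1 : ‖2 * (η x : ℂ) * conj ((w : L2) x) * ∑ i, grad w x i * (partialDeriv i η x : ℂ)‖ ≤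
        2 * |η x| * ‖(w : L2) x‖ * (‖grad w x‖ * ‖fderiv ℝ η x‖) := by
      rw [norm_mul, norm_mul, norm_mul, RCLike.norm_conj, Complex.norm_real, Complex.norm_two]
      exact mul_le_mul_of_nonneg_left (norm_sum_mul_partialDeriv_le η x _) (by positivity)
    have h2 := (abs_le.1 ((Complex.abs_re_le_norm _).trans h1)).1
    have h3 := mul_le_mul_of_nonneg_right (hD x) (sq_nonneg ‖(w : L2) x‖)
    -- Young's inequality, weighted to leave half of `η²|∇w|²`.
    have h4 := sq_nonneg (|η x| * ‖grad w x‖ - 2 * (‖(w : L2) x‖ * ‖fderiv ℝ η x‖))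
    have h5 := sq_abs (η x)
    nlinarith

/-- Agmon's weighted energy estimate. -/
theorem IsEigenfunction.weighted_energy_le {Ξ : Set R3} {σm σp : ℝ} (hσp : 0 < σp) {m α : ℝ}
    (hα : 0 < α) (hm : m = -(σp * α ^ 2)) {w : (nearField Ξ σm σp).domain}
    (hw : IsEigenfunction (nearField Ξ σm σp) (m : ℂ) w) (hnorm : ‖(w : L2)‖ = 1) {η : R3 → ℝ}
    (hη : ContDiff ℝ ∞ η) {A : ℝ} (hA : ∀ x, |η x| ≤ A) {R : ℝ}
    (hR : closure Ξ ⊆ Metric.ball 0 R)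
    (h0 : ∀ x ∈ Metric.ball (0 : R3) R, η x = 0) {K : ℝ} (hK : 0 ≤ K)
    (hD : ∀ x, ‖fderiv ℝ η x‖ ^ 2 ≤ (α / 2) ^ 2 * η x ^ 2 + K) :
    Integrable (fun x => η x ^ 2 * (‖(w : L2) x‖ ^ 2 + ‖grad (toH1 w) x‖ ^ 2)) ∧
    ∫ x, η x ^ 2 * (‖(w : L2) x‖ ^ 2 + ‖grad (toH1 w) x‖ ^ 2) ≤
      4 * K * (1 + 1 / α ^ 2) := by
  have hA0 : 0 ≤ A := (abs_nonneg _).trans (hA 0)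
  have hη2 : ∀ x, η x ^ 2 ≤ A ^ 2 := fun x => by
    rw [← sq_abs]
    exact pow_le_pow_left₀ (abs_nonneg _) (hA x) 2
  have hfd : ∀ x, ‖fderiv ℝ η x‖ ≤ Real.sqrt ((α / 2) ^ 2 * A ^ 2 + K) := fun x => by
    refine Real.le_sqrt_of_sq_le ((hD x).trans ?_)
    exact add_le_add (mul_le_mul_of_nonneg_left (hη2 x) (sq_nonneg _)) le_rfl
  have hbound : ∀ {f : R3 → ℝ}, Integrable f → Integrable fun x => η x ^ 2 * f x := fun hf =>
    hf.bdd_mul (c := A ^ 2) (hη.continuous.pow 2).aestronglyMeasurable (.of_forall fun x => by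
      rw [Real.norm_eq_abs, abs_of_nonneg (sq_nonneg _)]
      exact hη2 x)
  have iw := integrable_norm_sq (w : L2)
  have iW := hbound iw
  have iG := hbound (integrable_norm_sq_vec (grad (toH1 w)))
  have hθA : ∀ x, |η x * η x| ≤ A ^ 2 := fun x => by
    rw [← sq, abs_of_nonneg (sq_nonneg (η x))]
    exact hη2 x
  have hθB : ∀ i x, |partialDeriv i (fun y => η y * η y) x| ≤
      2 * (A * Real.sqrt ((α / 2) ^ 2 * A ^ 2 + K)) := fun i x => by
    rw [partialDeriv_mul hη hη, mul_comm (partialDeriv i η x), ← two_mul, abs_mul, abs_mul,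
      abs_two]
    gcongr
    · exact hA x
    · exact (abs_partialDeriv_le η i x).trans (hfd x)
  have hid := hw.integral_energyIntegrand (hη.mul hη) hθA hθB
  have hI : ∫ x, η x ^ 2 * ‖(w : L2) x‖ ^ 2 = ∫ x, η x * η x * ‖(w : L2) x‖ ^ 2 := by
    simp only [sq (η _)]
  rw [← hI] at hid
  set E := energyIntegrand (flux Ξ σm σp (toH1 w)) (grad (toH1 w)) (w : L2) (fun y => η y * η y)
  have hEint : Integrable E := integrable_energyIntegrand (hη.mul hη) hθA hθB
    (memLp_flux Ξ σm σp (toH1 w)) (Lp.memLp (w : L2)) (memLp_apply (grad (toH1 w)))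
  have hre : ∫ x, (E x).re = m * ∫ x, η x ^ 2 * ‖(w : L2) x‖ ^ 2 := by
    have := integral_re hEint
    simp only [RCLike.re_to_complex] at this
    rw [this, hid, ← Complex.ofReal_mul, Complex.ofReal_re]
  have i1 : Integrable fun x => 1 / 2 * (η x ^ 2 * ‖grad (toH1 w) x‖ ^ 2) -
      2 * (α / 2) ^ 2 * (η x ^ 2 * ‖(w : L2) x‖ ^ 2) := (iG.const_mul _).sub (iW.const_mul _)
  have hle := integral_mono (μ := volume) ((i1.sub (iw.const_mul (2 * K))).const_mul σp)
    hEint.re fun x => le_re_energyIntegrand hσp (toH1 w) hη hR h0 hK hD x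
  simp only [Pi.sub_apply] at hle
  rw [integral_const_mul, integral_sub i1 (iw.const_mul _), integral_sub (iG.const_mul _)
    (iW.const_mul _), integral_const_mul, integral_const_mul, integral_const_mul,
    integral_norm_sq_eq_one hnorm] at hle
  have hle' := hle.trans_eq hre
  simp only [mul_add]
  refine ⟨iW.add iG, ?_⟩
  rw [integral_add iW iG]
  have pW : 0 ≤ ∫ x, η x ^ 2 * ‖(w : L2) x‖ ^ 2 := integral_nonneg fun x => by positivity
  have pG : 0 ≤ ∫ x, η x ^ 2 * ‖grad (toH1 w) x‖ ^ 2 := integral_nonneg fun x => by positivity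
  set IW := ∫ x, η x ^ 2 * ‖(w : L2) x‖ ^ 2
  set IG := ∫ x, η x ^ 2 * ‖grad (toH1 w) x‖ ^ 2
  -- Divide by `σ₊`. The cross term costs `2(α/2)² = α²/2`, against `α²` from the eigenvalue.
  have hmain : 1 / 2 * IG + α ^ 2 / 2 * IW ≤ 2 * K := by
    rw [hm] at hle'
    have := le_of_mul_le_mul_left (a := σp) (b := 1 / 2 * IG - 2 * (α / 2) ^ 2 * IW - 2 * K * 1)
      (c := -(α ^ 2 * IW)) (by linarith) hσp
    nlinarith
  have hα2 : 0 < α ^ 2 := by positivity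
  have hIW : IW ≤ 4 * K * (1 / α ^ 2) := by
    rw [mul_one_div, le_div_iff₀ hα2]
    linarith
  have : 0 ≤ α ^ 2 / 2 * IW := by positivity
  linarith

/-! ### Passage to the limit in the weights -/

theorem mainTheorem9 (Ξ : Set R3) (hΞ : IsSmoothBoundedDomain Ξ) (h0 : (0 : R3) ∈ Ξ)
    (σm σp : ℝ) (hσm : σm < 0) (hσp : 0 < σp) (hκ : σm / σp ≠ -1)
    (μ : ℂ) (hμ : μ ∉ Complex.ofReal '' Set.Ici (0 : ℝ))
    (w : (nearField Ξ σm σp).domain)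
    (hw : IsEigenfunction (nearField Ξ σm σp) μ w) (hnorm : ‖(w : L2)‖ = 1) :
    ∫⁻ ξ : R3, ENNReal.ofReal
      ((‖(w : L2) ξ‖ ^ 2 + ‖grad (toH1 w) ξ‖ ^ 2) *
        Real.exp (‖ξ‖ * Real.sqrt (‖μ‖ / σp))) < ⊤ := by
  obtain ⟨m, hm, rfl⟩ := hw.exists_neg hμ hnorm
  have hmn : ‖(m : ℂ)‖ = -m := by rw [Complex.norm_real, Real.norm_eq_abs, abs_of_neg hm]
  rw [hmn]
  have hq : 0 < -m / σp := div_pos (neg_pos.2 hm) hσp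
  set α := Real.sqrt (-m / σp) with hαdef
  have hα : 0 < α := Real.sqrt_pos.2 hq
  have hmα : m = -(σp * α ^ 2) := by
    rw [hαdef, Real.sq_sqrt hq.le]
    field_simp
  obtain ⟨R, hR0, hR⟩ := hΞ.isBounded.closure.subset_ball_lt 0 (0 : R3)
  obtain ⟨η, η', K, C, hK, hC, hη, hηA, hη0, hηD, hηt, hηe⟩ :=
    -- The square of a weight of rate `α/2` grows like `exp(α|x|)`.
    exists_weights (a := α / 2) (by positivity) hR0
  set g : R3 → ℝ := fun x => ‖(w : L2) x‖ ^ 2 + ‖grad (toH1 w) x‖ ^ 2 with hg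
  have hg0 : ∀ x, 0 ≤ g x := fun x => by positivity
  have hgi : Integrable g := (integrable_norm_sq (w : L2)).add (integrable_norm_sq_vec _)
  have hen : ∀ n, Integrable (fun x => η n x ^ 2 * g x) ∧
      ∫ x, η n x ^ 2 * g x ≤ 4 * K * (1 + 1 / α ^ 2) := fun n => by
    obtain ⟨A, hA⟩ := hηA n
    exact hw.weighted_energy_le hσp hα hmα hnorm (hη n) hA hR (hη0 n) hK (hηD n)
  -- Fatou: the energy bounds are uniform in `n`.
  have hfatou : ∫⁻ x, ENNReal.ofReal (η' x ^ 2 * g x) < ⊤ := by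
    have hlim : ∀ x, ENNReal.ofReal (η' x ^ 2 * g x) =
        Filter.liminf (fun n => ENNReal.ofReal (η n x ^ 2 * g x)) Filter.atTop := fun x =>
      (((ENNReal.continuous_ofReal.tendsto _).comp
        (((hηt x).pow 2).mul_const (g x))).liminf_eq).symm
    simp only [hlim]
    refine (lintegral_liminf_le' fun n => (hen n).1.1.aemeasurable.ennreal_ofReal).trans_lt ?_
    refine lt_of_le_of_lt ?_ (ENNReal.ofReal_lt_top (r := 4 * K * (1 + 1 / α ^ 2)))
    refine Filter.liminf_le_of_le (by isBoundedDefault) fun b hb => ?_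
    obtain ⟨n, hn⟩ := hb.exists
    refine hn.trans ?_
    rw [← ofReal_integral_eq_lintegral_ofReal (hen n).1
      (.of_forall fun x => mul_nonneg (sq_nonneg _) (hg0 x))]
    exact ENNReal.ofReal_le_ofReal (hen n).2
  have hsplit : ∀ x, ENNReal.ofReal (g x * Real.exp (‖x‖ * α)) ≤
      ENNReal.ofReal (η' x ^ 2 * g x) + ENNReal.ofReal (C * g x) := fun x => by
    rw [← ENNReal.ofReal_add (mul_nonneg (sq_nonneg _) (hg0 x)) (mul_nonneg hC (hg0 x))]
    refine ENNReal.ofReal_le_ofReal ?_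
    have e : ‖x‖ * α = 2 * (α / 2) * ‖x‖ := by ring
    rw [e, ← add_mul, mul_comm]
    exact mul_le_mul_of_nonneg_right (hηe x) (hg0 x)
  refine (lintegral_mono hsplit).trans_lt ?_
  rw [lintegral_add_right' _ (hgi.const_mul C).1.aemeasurable.ennreal_ofReal]
  exact ENNReal.add_lt_top.2 ⟨hfatou, (hgi.const_mul C).lintegral_lt_top⟩
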